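/- Consider the repeated balls-into-bins (RBB) process with $m$ balls and $n$ bins. The balls are initially allocated arbitrarily, giving a load vector $x^0 \in \mathbb{Z}_{\ge 0}^n$ with $\sum_{i=1}^n x_i^0 = m$. For $t \ge 0$, let $\kappa^t := |\{ i : x_i^t > 0\}|$ be the number of non-empty bins after $t$ rounds. In the next round one ball is removed from each non-empty bin and each of these $\kappa^t$ balls is re-allocated to a bin chosen independently and uniformly at random, i.e. $$x_i^{t+1} = x_i^t - \mathbf{1}_{x_i^t > 0} + \sum_{j=1}^{\kappa^t} \mathbf{1}_{z_j^t = i}, \qquad i \in \{1,\dots,n\},$$ where the samples $z_j^t$ are mutually independent and uniform on $\{1,\dots,n\}$. Let $n \ge 1$, let $m$ be an integer with $n \le m \le n^k$ for some real constant $k \ge 1$, and let $\gamma := \frac{n}{4m}$. Then for every initial load vector, every integer $t_0 \ge 0$, and $t_1 := t_0 + \frac{1-\gamma}{200} \cdot \frac{1}{\gamma^2} \cdot (\log n)^4$ (natural logarithm), $$\Pr\left[ \bigcup_{t \in [t_0,t_1] \cap \mathbb{Z}} \left\{ \max_{1 \le i \le n} x_i^t \ge 0.008 \cdot \frac{m}{n}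 \cdot \log n \right\} \right] \ge 1 - n^{-1}.$$ -/

import Mathlib

open MeasureTheory ProbabilityTheory

namespace RBB

/-- The number of non-empty bins of a load vector `x` on `n` bins. -/
def numNonempty {n : ℕ} (x : Fin n → ℕ) : ℕ :=
  (Finset.univ.filter fun i => 0 < x i).card

/-- One round of the repeated balls-into-bins process: with `κ` the number of non-empty bins of `x`,
one ball is removed from each non-empty bin, and the `κ` removed balls are placed into the bins
`z 0, …, z (κ - 1)`. The samples `z j` with `j ≥ κ` are not used. -/
def step {n : ℕ} (x : Fin n → ℕ) (z : Fin n → Fin n) : Fin n → ℕ := fun i =>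
  x i - (if 0 < x i then 1 else 0)
    + (Finset.univ.filter fun j : Fin n => (j : ℕ) < numNonempty x ∧ z j = i).card

/-- The load vector after `t` rounds, started from the load vector `x₀`, where the samples
`z t 0, z t 1, …` are used to go from round `t` to round `t + 1`. -/
def load {n : ℕ} (x₀ : Fin n → ℕ) (z : ℕ → Fin n → Fin n) : ℕ → Fin n → ℕ
  | 0 => x₀
  | t + 1 => step (load x₀ z t) (z t)

/-- The maximum load of a load vector. -/
def maxLoad {n : ℕ} (x : Fin n → ℕ) : ℕ := Finset.univ.sup x

/-- The samples `Z t j` (round `t`, sample `j`) are mutually independent and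
uniformly distributed over the `n` bins. -/
structure IsUniformSamples {Ω : Type*} [MeasurableSpace Ω] (μ : Measure Ω) {n : ℕ}
    (Z : ℕ → Fin n → Ω → Fin n) : Prop where
  measurable : ∀ t j, Measurable (Z t j)
  uniform : ∀ t j i, μ (Z t j ⁻¹' {i}) = (n : ENNReal)⁻¹
  indep : iIndepFun (fun p : ℕ × Fin n => Z p.1 p.2) μ

end RBB

/-!
Write `r = m / n`, `l = log n` and `L = 0.008 r l`. If `l ≤ 125`, then `L` is at most the average
load. Otherwise the window is cut into more than `25 l` blocks of `T + 1` rounds, where `T` is about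
`0.1 r² l`. From every load vector with `m` balls, all loads stay below `L` throughout a block with
probability at most `0.96` (`survival_block_le`), so by the Markov property the whole window is
survived with probability at most `0.96 ^ J ≤ 1 / n` (`IsUniformSamples.measureReal_survival_le`).
Since the blocks restart from an arbitrary load vector, a constant success probability per block is
enough, and no concentration of the number of empty bins is needed.

For one block, let `Y i` be the number of balls thrown into bin `i` and `K` the number of all balls
thrown. Three facts are combined.

* The quadratic potential `∑ i, x i ^ 2` drops in mean by `2 r` per empty bin, up to an error `n` per
  round (`expect_sum_sq_step_le`), and it is at most `m L` at the start of a block that is not over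
  at once. By Markov's inequality, not many bins are empty during the block, and `K` is close enough
  to `n T`.
* For every `A`, the weights `A ^ Y i / (1 + (A - 1) / n) ^ K` are martingales, although `K` is
  random. Weights of different bins are negatively correlated, and the second moment of one weight
  is at most `exp ((A - 1) ^ 2 T)`. For `A = 1 + O(1 / r)` this is a power of `n` with exponent
  below `1`, so the mean of the weights over the bins is close to `1` with high probability
  (`weightVariance_start_le`).
* If all loads are below `L` at the end, then `Y i ≤ L + T` for all `i`, and the mean weight for
  `A = 1 + 2.5 / r` is smaller by a constant factor than the one for `B = 1 + 2 / r`
  (`meanWeight_le_exp_mul`). So they cannot both be close to `1`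
  (`Counted.Valid.not_concentrated`).

The three facts are added up in a single supermartingale.
-/

namespace RBB
open Finset
open scoped BigOperators

/-! ### Averages over one round of samples -/

/-- The number of balls that bin `i` receives in one round from the load vector `x`. -/
def arrivals {n : ℕ} (x : Fin n → ℕ) (ζ : Fin n → Fin n) (i : Fin n) : ℕ :=
  (univ.filter fun j : Fin n => (j : ℕ) < numNonempty x ∧ ζ j = i).card

lemma numNonempty_le {n : ℕ} (x : Fin n → ℕ) : numNonempty x ≤ n := by
  simpa [numNonempty] using card_filter_le (univ : Finset (Fin n)) fun i => 0 < x i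

lemma card_filter_lt_numNonempty {n : ℕ} (x : Fin n → ℕ) :
    (univ.filter fun j : Fin n => (j : ℕ) < numNonempty x).card = numNonempty x := by
  rw [Fin.card_filter_val_lt, min_eq_right (numNonempty_le x)]

lemma expect_prod {n : ℕ} (f : Fin n → Fin n → ℝ) :
    𝔼 ζ : Fin n → Fin n, ∏ j, f j (ζ j) = ∏ j, 𝔼 i, f j i := by
  simp only [Fintype.expect_eq_sum_div_card]
  rw [prod_div_distrib, Finset.prod_univ_sum, Fintype.piFinset_univ]
  simp

lemma expect_pow_arrivals_mul {n : ℕ} (x : Fin n → ℕ) (A B : ℝ) (i i' : Fin n) :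
    𝔼 ζ : Fin n → Fin n, A ^ arrivals x ζ i * B ^ arrivals x ζ i'
      = (𝔼 v : Fin n, (if v = i then A else 1) * (if v = i' then B else 1)) ^ numNonempty x := by
  have key : ∀ ζ : Fin n → Fin n, A ^ arrivals x ζ i * B ^ arrivals x ζ i'
      = ∏ j : Fin n, if (j : ℕ) < numNonempty x then
        (if ζ j = i then A else 1) * (if ζ j = i' then B else 1) else 1 := by
    intro ζ
    rw [← prod_filter, prod_mul_distrib, prod_ite, prod_ite]
    simp [arrivals, filter_filter]
  simp only [key]
  rw [expect_prod (fun j v => if (j : ℕ) < numNonempty x then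
        (if v = i then A else 1) * (if v = i' then B else 1) else 1)]
  conv_rhs => rw [← card_filter_lt_numNonempty x]
  rw [← prod_const, prod_filter]
  refine prod_congr rfl fun j _ => ?_
  have : Nonempty (Fin n) := ⟨j⟩
  split_ifs <;> simp

lemma expect_pow_arrivals {n : ℕ} (hn : 1 ≤ n) (x : Fin n → ℕ) (A : ℝ) (i : Fin n) :
    𝔼 ζ : Fin n → Fin n, A ^ arrivals x ζ i = (1 + (A - 1) / n) ^ numNonempty x := by
  have h := expect_pow_arrivals_mul x A 1 i i
  simp only [one_pow, mul_one, ite_self] at h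
  rw [h, Fintype.expect_eq_sum_div_card]
  have : ∀ v : Fin n, (if v = i then A else 1) = 1 + if v = i then A - 1 else 0 := by
    intro v; split_ifs <;> ring
  simp only [this, sum_add_distrib, sum_ite_eq', mem_univ, if_true]
  have : (n : ℝ) ≠ 0 := by positivity
  simp; field_simp

lemma expect_pow_arrivals_mul_of_ne {n : ℕ} (hn : 1 ≤ n) (x : Fin n → ℕ) (A : ℝ) {i i' : Fin n}
    (hi : i ≠ i') :
    𝔼 ζ : Fin n → Fin n, A ^ arrivals x ζ i * A ^ arrivals x ζ i'
      = (1 + 2 * (A - 1) / n) ^ numNonempty x := by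
  rw [expect_pow_arrivals_mul, Fintype.expect_eq_sum_div_card]
  have : ∀ v : Fin n, (if v = i then A else 1) * (if v = i' then A else 1)
      = 1 + (if v = i then A - 1 else 0) + if v = i' then A - 1 else 0 := by
    intro v
    split_ifs with h1 h2
    · exact absurd (h1.symm.trans h2) hi
    all_goals ring
  simp only [this, sum_add_distrib, sum_ite_eq', mem_univ, if_true]
  have : (n : ℝ) ≠ 0 := by positivity
  congr 1
  simp; field_simp; ring

lemma expect_forall_eq {n : ℕ} (s : Finset (Fin n)) (i : Fin n) :
    𝔼 ζ : Fin n → Fin n, (if ∀ j ∈ s, ζ j = i then (1 : ℝ) else 0) = (1 / (n : ℝ)) ^ s.card := by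
  have key : ∀ ζ : Fin n → Fin n, (if ∀ j ∈ s, ζ j = i then (1 : ℝ) else 0)
      = ∏ j, if j ∈ s then (if ζ j = i then (1 : ℝ) else 0) else 1 := by
    intro ζ
    rw [Fintype.prod_ite_mem, prod_ite_zero]
    simp
  simp only [key]
  rw [expect_prod (fun j v => if j ∈ s then (if v = i then (1 : ℝ) else 0) else 1)]
  conv_rhs => rw [← prod_const, ← Fintype.prod_ite_mem]
  refine prod_congr rfl fun j _ => ?_
  have : Nonempty (Fin n) := ⟨j⟩
  split_ifs <;> simp

lemma expect_arrivals {n : ℕ} (x : Fin n → ℕ) (i : Fin n) :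
    𝔼 ζ : Fin n → Fin n, (arrivals x ζ i : ℝ) = numNonempty x / n := by
  have key : ∀ ζ : Fin n → Fin n, (arrivals x ζ i : ℝ)
      = ∑ j ∈ univ.filter fun j : Fin n => (j : ℕ) < numNonempty x,
        if ∀ k ∈ ({j} : Finset (Fin n)), ζ k = i then (1 : ℝ) else 0 := by
    intro ζ
    simp [arrivals, sum_boole, filter_filter]
  simp only [key]
  rw [expect_sum_comm]
  simp only [expect_forall_eq, card_singleton, sum_const, card_filter_lt_numNonempty]
  simp [div_eq_mul_inv]

lemma expect_arrivals_sq_le {n : ℕ} (x : Fin n → ℕ) (i : Fin n) :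
    𝔼 ζ : Fin n → Fin n, (arrivals x ζ i : ℝ) ^ 2
      ≤ numNonempty x / n + (numNonempty x / n : ℝ) ^ 2 := by
  have key : ∀ ζ : Fin n → Fin n, (arrivals x ζ i : ℝ) ^ 2
      = ∑ j ∈ univ.filter fun j : Fin n => (j : ℕ) < numNonempty x,
        ∑ k ∈ univ.filter fun j : Fin n => (j : ℕ) < numNonempty x,
        if ∀ l ∈ ({j, k} : Finset (Fin n)), ζ l = i then (1 : ℝ) else 0 := by
    intro ζ
    have : (arrivals x ζ i : ℝ) = ∑ j ∈ univ.filter fun j : Fin n => (j : ℕ) < numNonempty x,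
        if ζ j = i then (1 : ℝ) else 0 := by
      simp [arrivals, sum_boole, filter_filter]
    rw [this, sq, sum_mul_sum]
    refine sum_congr rfl fun j _ => sum_congr rfl fun k _ => ?_
    by_cases h1 : ζ j = i <;> by_cases h2 : ζ k = i <;> simp [h1, h2]
  simp only [key]
  rw [expect_sum_comm]
  simp only [expect_sum_comm, expect_forall_eq]
  calc _ ≤ ∑ j ∈ univ.filter fun j : Fin n => (j : ℕ) < numNonempty x,
        ∑ k ∈ univ.filter fun j : Fin n => (j : ℕ) < numNonempty x,
        ((if j = k then 1 / (n : ℝ) else 0) + (1 / (n : ℝ)) ^ 2) := by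
        refine sum_le_sum fun j _ => sum_le_sum fun k _ => ?_
        by_cases h : j = k
        · subst h; simp
        · simp [h, card_pair h]
    _ = _ := by
        simp only [sum_add_distrib, sum_const, card_filter_lt_numNonempty, sum_ite_eq]
        rw [sum_congr rfl (g := fun _ => 1 / (n : ℝ)) (fun j hj => if_pos hj)]
        simp only [sum_const, card_filter_lt_numNonempty, nsmul_eq_mul]
        ring

/-! ### One round of the process -/

lemma sum_arrivals {n : ℕ} (x : Fin n → ℕ) (ζ : Fin n → Fin n) :
    ∑ i, arrivals x ζ i = numNonempty x := by
  have h := card_eq_sum_card_fiberwise (s := univ.filter fun j : Fin n => (j : ℕ) < numNonempty x)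
    (t := univ) (f := ζ) (fun _ _ => mem_coe.2 (mem_univ _))
  rw [card_filter_lt_numNonempty] at h
  rw [h]
  simp [arrivals, filter_filter]

lemma sum_step {n : ℕ} (x : Fin n → ℕ) (ζ : Fin n → Fin n) : ∑ i, step x ζ i = ∑ i, x i := by
  have h1 : ∑ i, step x ζ i = ∑ i, (x i - if 0 < x i then 1 else 0) + numNonempty x := by
    rw [← sum_arrivals x ζ, ← sum_add_distrib]; rfl
  have h2 : numNonempty x = ∑ i, if 0 < x i then 1 else 0 := by simp [numNonempty]
  rw [h1, h2, ← sum_add_distrib]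
  refine sum_congr rfl fun i _ => ?_
  split_ifs <;> omega

/-- The quadratic potential drops by `2m` times the fraction of empty bins, up to an error `n`. -/
lemma expect_sum_sq_step_le {n : ℕ} (hn : 1 ≤ n) (x : Fin n → ℕ) (m : ℕ) (hx : ∑ i, x i = m) :
    𝔼 ζ : Fin n → Fin n, ∑ i, (step x ζ i : ℝ) ^ 2
      ≤ ∑ i, (x i : ℝ) ^ 2 - 2 * (m / n) * (n - numNonempty x) + n := by
  have hn0 : (0 : ℝ) < n := by exact_mod_cast hn
  have : Nonempty (Fin n) := ⟨⟨0, hn⟩⟩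
  set κ : ℝ := (numNonempty x : ℝ) with hκ
  set d : Fin n → ℝ := fun i => (x i : ℝ) - if 0 < x i then 1 else 0 with hd
  have hstep : ∀ ζ i, (step x ζ i : ℝ) = d i + arrivals x ζ i := by
    intro ζ i
    simp only [step, hd, arrivals]
    push_cast
    congr 1
    split_ifs with h
    · rw [Nat.cast_sub h]; simp
    · simp
  have hκs : κ = ∑ i, if 0 < x i then (1 : ℝ) else 0 := by simp [hκ, numNonempty]
  have hm : (m : ℝ) = ∑ i, (x i : ℝ) := by rw [← hx]; push_cast; rfl
  have hd1 : ∑ i, d i = m - κ := by rw [hκs, hm, ← sum_sub_distrib]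
  have hd2 : ∑ i, d i ^ 2 = ∑ i, (x i : ℝ) ^ 2 - 2 * m + κ := by
    rw [hκs, hm, mul_sum, ← sum_sub_distrib, ← sum_add_distrib]
    refine sum_congr rfl fun i _ => ?_
    simp only [hd]
    split_ifs with h
    · ring
    · have : x i = 0 := by omega
      simp [this]
  have hi : ∀ i, 𝔼 ζ : Fin n → Fin n, (step x ζ i : ℝ) ^ 2
      ≤ d i ^ 2 + 2 * d i * (κ / n) + (κ / n + (κ / n) ^ 2) := by
    intro i
    have : ∀ ζ, (step x ζ i : ℝ) ^ 2
        = d i ^ 2 + 2 * d i * arrivals x ζ i + (arrivals x ζ i : ℝ) ^ 2 := by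
      intro ζ; rw [hstep]; ring
    simp only [this, expect_add_distrib]
    rw [← mul_expect, expect_arrivals, Fintype.expect_const]
    have := expect_arrivals_sq_le x i
    linarith
  rw [expect_sum_comm]
  refine (sum_le_sum fun i _ => hi i).trans ?_
  rw [sum_add_distrib, sum_add_distrib, hd2, ← sum_mul, ← mul_sum, hd1]
  simp only [sum_const, card_univ, Fintype.card_fin, nsmul_eq_mul]
  have e : (n : ℝ) - (2 * κ - κ ^ 2 / n) = (n - κ) ^ 2 / n := by field_simp; ring
  have e' : 0 ≤ ((n : ℝ) - κ) ^ 2 / n := by positivity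
  have e2 : ∑ i, (x i : ℝ) ^ 2 - 2 * ↑m + κ + 2 * (↑m - κ) * (κ / ↑n) + ↑n * (κ / ↑n + (κ / ↑n) ^ 2)
      = ∑ i, (x i : ℝ) ^ 2 - 2 * (m / n) * (n - κ) + (2 * κ - κ ^ 2 / n) := by
    field_simp; ring
  rw [e2]
  linarith

/-! ### Averaging operators of chains driven by uniform samples -/

open Classical in
/-- One step of the chain with transition map `upd` driven by uniform samples, killed outside `U`:
`killed upd U V s` is the mean of `V` after one step from `s` if `s` satisfies `U`, and `0`
otherwise. -/
noncomputable def killed {σ : Type*} {n : ℕ} (upd : σ → (Fin n → Fin n) → σ) (U : σ → Prop)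
    (V : σ → ℝ) (s : σ) : ℝ :=
  if U s then 𝔼 ζ : Fin n → Fin n, V (upd s ζ) else 0

section killed

variable {σ : Type*} {n : ℕ} {upd : σ → (Fin n → Fin n) → σ} {U : σ → Prop}

/-- Monotonicity of the iterates, where the comparison of the final values is needed only for the
states that can be reached. -/
lemma killed_iterate_mono {Inv : ℕ → σ → Prop}
    (hInv : ∀ t s ζ, Inv t s → Inv (t + 1) (upd s ζ)) {V V' : σ → ℝ} (T : ℕ) :
    ∀ (t : ℕ) (s : σ), (∀ s, Inv (t + T) s → V s ≤ V' s) → Inv t s →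
      (killed upd U)^[T] V s ≤ (killed upd U)^[T] V' s := by
  induction T with
  | zero => intro t s h hs; exact h s hs
  | succ T ih =>
    intro t s h hs
    rw [Function.iterate_succ_apply', Function.iterate_succ_apply', killed, killed]
    split_ifs
    · refine expect_le_expect fun ζ _ => ih (t + 1) _ (fun s' hs' => h s' ?_) (hInv t s ζ hs)
      rwa [show t + (T + 1) = t + 1 + T by omega]
    · exact le_rfl

/-- If `V k`, a function of the state with `k` steps to go, is a nonnegative supermartingale,
its value at the start bounds its mean at the end, also with killing. -/
lemma killed_iterate_le_of_supermartingale {Inv : σ → Prop}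
    (hInv : ∀ s ζ, Inv s → Inv (upd s ζ)) (V : ℕ → σ → ℝ) (h0 : ∀ k s, Inv s → 0 ≤ V k s)
    (hV : ∀ k s, Inv s → 𝔼 ζ : Fin n → Fin n, V k (upd s ζ) ≤ V (k + 1) s) (T : ℕ) :
    ∀ s, Inv s → (killed upd U)^[T] (V 0) s ≤ V T s := by
  induction T with
  | zero => intro s _; exact le_rfl
  | succ T ih =>
    intro s hs
    rw [Function.iterate_succ_apply', killed]
    split_ifs
    · exact (expect_le_expect fun ζ _ => ih _ (hInv s ζ hs)).trans (hV T s hs)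
    · exact h0 _ _ hs

lemma killed_iterate_comp {τ : Type*} {upd' : τ → (Fin n → Fin n) → τ} {π : τ → σ}
    (hπ : ∀ s ζ, π (upd' s ζ) = upd (π s) ζ) (V : σ → ℝ) (T : ℕ) :
    ∀ s, (killed upd' (fun s => U (π s)))^[T] (fun s => V (π s)) s
      = (killed upd U)^[T] V (π s) := by
  induction T with
  | zero => intro s; rfl
  | succ T ih =>
    intro s
    rw [Function.iterate_succ_apply', Function.iterate_succ_apply', killed, killed]
    simp only [ih, hπ]

lemma killed_iterate_smul (c : ℝ) (V : σ → ℝ) (T : ℕ) :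
    ∀ s, (killed upd U)^[T] (fun s => c * V s) s = c * (killed upd U)^[T] V s := by
  induction T with
  | zero => intro s; rfl
  | succ T ih =>
    intro s
    rw [Function.iterate_succ_apply', Function.iterate_succ_apply', killed, killed]
    simp only [ih, ← mul_expect, mul_ite, mul_zero]

/-- The restart argument: if every start survives a block of `T` steps with probability at most
`q`, then `J` blocks are survived with probability at most `q ^ J`. -/
lemma killed_iterate_mul_le_pow {Inv : σ → Prop} (hInv : ∀ s ζ, Inv s → Inv (upd s ζ))
    {T : ℕ} {q : ℝ} (hq : 0 ≤ q) (h : ∀ s, Inv s → (killed upd U)^[T] (fun _ => 1) s ≤ q) (J : ℕ) :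
    ∀ s, Inv s → (killed upd U)^[T * J] (fun _ => 1) s ≤ q ^ J := by
  induction J with
  | zero => intro s _; simp
  | succ J ih =>
    intro s hs
    rw [mul_add_one, add_comm, Function.iterate_add_apply]
    refine (killed_iterate_mono (Inv := fun _ => Inv) (fun _ => hInv) (V' := fun _ => q ^ J * 1) T 0
      s (fun s hs => by simpa using ih s hs) hs).trans ?_
    rw [killed_iterate_smul, pow_succ]
    exact mul_le_mul_of_nonneg_left (h s hs) (pow_nonneg hq J)

end killed

/-! ### The Markov property of the process -/

lemma load_congr {n : ℕ} (x₀ : Fin n → ℕ) {z z' : ℕ → Fin n → Fin n} (t : ℕ)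
    (h : ∀ s < t, z s = z' s) : load x₀ z t = load x₀ z' t := by
  induction t with
  | zero => rfl
  | succ t ih =>
    rw [load, load, ih fun s hs => h s (by omega), h t (by omega)]

lemma sum_load {n : ℕ} (x₀ : Fin n → ℕ) (z : ℕ → Fin n → Fin n) (t : ℕ) :
    ∑ i, load x₀ z t i = ∑ i, x₀ i := by
  induction t with
  | zero => rfl
  | succ t ih => rw [load, sum_step, ih]

section samples

variable {Ω : Type*} [MeasurableSpace Ω] {μ : Measure Ω} {n : ℕ}
  {Z : ℕ → Fin n → Ω → Fin n}

lemma IsUniformSamples.measure_eq (hZ : IsUniformSamples μ Z) (t : ℕ) (ζ : Fin n → Fin n) :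
    μ {ω | (fun j => Z t j ω) = ζ} = ((n : ENNReal)⁻¹) ^ n := by
  have h := hZ.indep.measure_inter_preimage_eq_mul
    ((univ : Finset (Fin n)).map ⟨fun j => (t, j), fun a b h => (Prod.mk.inj h).2⟩)
    (sets := fun p => {ζ p.2}) (fun _ _ => measurableSet_singleton _)
  simp only [hZ.uniform, prod_const, card_map, card_univ, Fintype.card_fin] at h
  rw [← h]
  congr 1
  ext ω
  simp [funext_iff]
  rfl

lemma IsUniformSamples.measurable_round (hZ : IsUniformSamples μ Z) (t : ℕ) :
    Measurable fun ω j => Z t j ω :=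
  measurable_pi_iff.2 fun j => hZ.measurable t j

lemma IsUniformSamples.indepFun_past [IsProbabilityMeasure μ]
    (hZ : IsUniformSamples μ Z) (t : ℕ) :
    IndepFun (fun ω (s : Fin t) j => Z s j ω) (fun ω j => Z t j ω) μ := by
  have hd : Disjoint (range t ×ˢ (univ : Finset (Fin n))) ({t} ×ˢ (univ : Finset (Fin n))) := by
    rw [disjoint_left]
    rintro ⟨s, j⟩ h1 h2
    simp at h1 h2
    omega
  have h := hZ.indep.indepFun_finset _ _ hd fun p => hZ.measurable p.1 p.2
  let φ : ((range t ×ˢ (univ : Finset (Fin n)) : Finset (ℕ × Fin n)) → Fin n) →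
      Fin t → Fin n → Fin n := fun a s j => a ⟨(s, j), by simp⟩
  let ψ : (({t} ×ˢ (univ : Finset (Fin n)) : Finset (ℕ × Fin n)) → Fin n) → Fin n → Fin n :=
    fun a j => a ⟨(t, j), by simp⟩
  exact h.comp (φ := φ) (ψ := ψ) (measurable_of_finite _) (measurable_of_finite _)

/-- The samples of round `t` are averaged out of a function of the rounds up to `t`. -/
lemma IsUniformSamples.integral_eq_integral_expect [IsProbabilityMeasure μ]
    (hZ : IsUniformSamples μ Z) (t : ℕ)
    (G : (ℕ → Fin n → Fin n) → (Fin n → Fin n) → ℝ)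
    (hG : ∀ z z', (∀ s < t, z s = z' s) → G z = G z') :
    ∫ ω, G (fun s j => Z s j ω) (fun j => Z t j ω) ∂μ
      = ∫ ω, 𝔼 ζ, G (fun s j => Z s j ω) ζ ∂μ := by
  let ext : (Fin t → Fin n → Fin n) → ℕ → Fin n → Fin n :=
    fun a s => if h : s < t then a ⟨s, h⟩ else id
  let H : Ω → Fin t → Fin n → Fin n := fun ω s j => Z s j ω
  have hH : Measurable H :=
    measurable_pi_iff.2 fun s => hZ.measurable_round s
  have hR := hZ.measurable_round t
  have hGH : ∀ ω, G (fun s j => Z s j ω) = G (ext (H ω)) := by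
    intro ω
    refine hG _ _ fun s hs => ?_
    simp [ext, hs, H]
  simp only [hGH]
  have hind := (indepFun_iff_map_prod_eq_prod_map_map hH.aemeasurable hR.aemeasurable).1
    (hZ.indepFun_past t)
  have : IsProbabilityMeasure (μ.map H) := Measure.isProbabilityMeasure_map hH.aemeasurable
  have : IsProbabilityMeasure (μ.map fun ω j => Z t j ω) :=
    Measure.isProbabilityMeasure_map hR.aemeasurable
  have e1 : ∫ ω, G (ext (H ω)) (fun j => Z t j ω) ∂μ
      = ∫ p, G (ext p.1) p.2 ∂((μ.map H).prod (μ.map fun ω j => Z t j ω)) := by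
    rw [← hind, integral_map (hH.prodMk hR).aemeasurable
      (measurable_of_finite _).aestronglyMeasurable]
  have e2 : ∫ ω, 𝔼 ζ, G (ext (H ω)) ζ ∂μ = ∫ a, 𝔼 ζ, G (ext a) ζ ∂(μ.map H) := by
    rw [integral_map hH.aemeasurable (measurable_of_finite _).aestronglyMeasurable]
  rw [e1, e2, integral_prod _ Integrable.of_finite]
  congr 1
  ext a
  rw [integral_fintype Integrable.of_finite, Fintype.expect_eq_sum_div_card, sum_div]
  refine sum_congr rfl fun ζ _ => ?_
  rw [map_measureReal_apply hR (measurableSet_singleton _)]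
  have := hZ.measure_eq t ζ
  rw [measureReal_def, show (fun ω j => Z t j ω) ⁻¹' {ζ} = {ω | (fun j => Z t j ω) = ζ} from rfl,
    this]
  simp [div_eq_inv_mul]

open Classical in
/-- The probability that the process stays in `U` during the rounds `t₀, …, t₀ + N - 1`, in terms of
the averaging operators. -/
lemma IsUniformSamples.integral_survival [IsProbabilityMeasure μ]
    (hZ : IsUniformSamples μ Z) (x₀ : Fin n → ℕ)
    (U : (Fin n → ℕ) → Prop) (t₀ : ℕ) (N : ℕ) : ∀ h : (Fin n → ℕ) → ℝ,
    ∫ ω, (if ∀ s < N, U (load x₀ (fun s j => Z s j ω) (t₀ + s)) then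
        h (load x₀ (fun s j => Z s j ω) (t₀ + N)) else 0) ∂μ
      = (killed step fun _ => True)^[t₀] ((killed step U)^[N] h) x₀ := by
  induction N with
  | zero =>
    simp only [not_lt_zero, false_imp_iff, imp_true_iff, if_true, add_zero,
      Function.iterate_zero, id_eq]
    induction t₀ with
    | zero => intro h; simp [load]
    | succ t ih =>
      intro h
      rw [Function.iterate_succ_apply, ← ih]
      refine (hZ.integral_eq_integral_expect t (fun z ζ => h (step (load x₀ z t) ζ))
        fun z z' hz => ?_).trans ?_
      · simp only [load_congr x₀ t hz]
      · simp [killed]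
  | succ N ih =>
    intro h
    rw [Function.iterate_succ_apply, ← ih]
    refine Eq.trans ?_ ((hZ.integral_eq_integral_expect (t₀ + N)
      (fun z ζ => if ∀ s < N + 1, U (load x₀ z (t₀ + s)) then h (step (load x₀ z (t₀ + N)) ζ) else 0)
        fun z z' hz => ?_).trans ?_)
    · rfl
    · have h1 : ∀ s < N + 1, load x₀ z (t₀ + s) = load x₀ z' (t₀ + s) :=
        fun s hs => load_congr x₀ _ fun r hr => hz r (by omega)
      have h2 : (∀ s < N + 1, U (load x₀ z (t₀ + s))) ↔ ∀ s < N + 1, U (load x₀ z' (t₀ + s)) :=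
        forall₂_congr fun s hs => by rw [h1 s hs]
      simp only [h2, h1 N (by omega)]
    · congr 1
      ext ω
      simp only [Nat.forall_lt_succ_right, killed]
      split_ifs <;> simp_all

end samples

/-! ### The process with counters -/

/-- A load vector together with counters for what has happened so far: `Y i` balls were thrown into
bin `i`, `K` balls were thrown in total, and `E` is the sum over the rounds of the number of empty
bins. -/
structure Counted (n : ℕ) where
  x : Fin n → ℕ
  Y : Fin n → ℕ
  K : ℕ
  E : ℕ

/-- One round of the process, with the counters kept up to date. -/
def countedStep {n : ℕ} (s : Counted n) (ζ : Fin n → Fin n) : Counted n where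
  x := step s.x ζ
  Y i := s.Y i + arrivals s.x ζ i
  K := s.K + numNonempty s.x
  E := s.E + (n - numNonempty s.x)

/-- The relations between the counters after `t` rounds with `m` balls. A bin has lost at most `t`
balls by then. -/
structure Counted.Valid {n : ℕ} (m t : ℕ) (s : Counted n) : Prop where
  sum_eq : ∑ i, s.x i = m
  le_add : ∀ i, s.Y i ≤ s.x i + t
  add_eq : s.K + s.E = n * t

lemma Counted.Valid.countedStep {n m t : ℕ} {s : Counted n} (h : s.Valid m t)
    (ζ : Fin n → Fin n) : (RBB.countedStep s ζ).Valid m (t + 1) where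
  sum_eq := (sum_step s.x ζ).trans h.sum_eq
  le_add i := by
    have := h.le_add i
    simp only [RBB.countedStep, step, arrivals]
    split_ifs <;> omega
  add_eq := by
    have := h.add_eq
    have := numNonempty_le s.x
    simp only [RBB.countedStep, mul_add_one]
    omega

/-! ### Exponential weights -/

/-- The martingale `A ^ Y i / (1 + (A - 1) / n) ^ K`: each thrown ball multiplies the numerator by
a factor of mean `1 + (A - 1) / n`. -/
noncomputable def weight {n : ℕ} (A : ℝ) (s : Counted n) (i : Fin n) : ℝ :=
  A ^ s.Y i / (1 + (A - 1) / n) ^ s.K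

/-- The mean of the weights over the bins. -/
noncomputable def meanWeight {n : ℕ} (A : ℝ) (s : Counted n) : ℝ :=
  (∑ i, weight A s i) / n

/-- A supermartingale that controls the second moment of `meanWeight A - 1`, with `k` rounds to go:
the squares of the weights grow by a factor of at most `exp ((A - 1) ^ 2)` per round, and the mixed
products do not grow. -/
noncomputable def weightVariance {n : ℕ} (A : ℝ) (k : ℕ) (s : Counted n) : ℝ :=
  (∑ i, ∑ i', (if i = i' then Real.exp ((A - 1) ^ 2) ^ k else 1) * (weight A s i * weight A s i'))
    / n ^ 2 - 2 * meanWeight A s + 1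

section weight

variable {n : ℕ} {A : ℝ}

lemma weight_nonneg (hA : 1 ≤ A) (s : Counted n) (i : Fin n) : 0 ≤ weight A s i := by
  have : 0 ≤ (A - 1) / n := div_nonneg (by linarith) (by positivity)
  unfold weight
  positivity

lemma weight_countedStep (s : Counted n) (ζ : Fin n → Fin n) (i : Fin n) :
    weight A (countedStep s ζ) i
      = weight A s i * (A ^ arrivals s.x ζ i / (1 + (A - 1) / n) ^ numNonempty s.x) := by
  simp only [weight, countedStep, pow_add]
  rw [mul_div_mul_comm]

lemma expect_weight (hn : 1 ≤ n) (hA : 1 ≤ A) (s : Counted n) (i : Fin n) :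
    𝔼 ζ, weight A (countedStep s ζ) i = weight A s i := by
  have : 0 ≤ (A - 1) / n := div_nonneg (by linarith) (by positivity)
  simp only [weight_countedStep]
  rw [← mul_expect, ← expect_div, expect_pow_arrivals hn, div_self (by positivity), mul_one]

lemma expect_weight_mul (s : Counted n) (i i' : Fin n) :
    𝔼 ζ, weight A (countedStep s ζ) i * weight A (countedStep s ζ) i'
      = weight A s i * weight A s i' *
        ((𝔼 ζ : Fin n → Fin n, A ^ arrivals s.x ζ i * A ^ arrivals s.x ζ i')
          / ((1 + (A - 1) / n) ^ 2) ^ numNonempty s.x) := by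
  rw [expect_div, mul_expect]
  refine expect_congr rfl fun ζ _ => ?_
  rw [weight_countedStep, weight_countedStep, mul_mul_mul_comm, div_mul_div_comm, ← mul_pow, sq,
    mul_pow]

lemma expect_weight_mul_le (hn : 1 ≤ n) (hA : 1 ≤ A) (s : Counted n) (i i' : Fin n) :
    𝔼 ζ, weight A (countedStep s ζ) i * weight A (countedStep s ζ) i'
      ≤ (if i = i' then Real.exp ((A - 1) ^ 2) else 1) * (weight A s i * weight A s i') := by
  have hn0 : (0 : ℝ) < n := by exact_mod_cast hn
  have hw : 0 ≤ A - 1 := by linarith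
  have h0 := mul_nonneg (weight_nonneg hA s i) (weight_nonneg hA s i')
  rw [expect_weight_mul, mul_comm (ite _ _ _)]
  refine mul_le_mul_of_nonneg_left ?_ h0
  rw [div_le_iff₀ (by positivity)]
  split_ifs with h
  · subst h
    simp only [← mul_pow]
    rw [expect_pow_arrivals hn]
    set w := A - 1
    have hAw : A * A - 1 = 2 * w + w ^ 2 := by simp only [w]; ring
    have h1 : 1 + (A * A - 1) / n ≤ (1 + w ^ 2 / n) * (1 + w / n) ^ 2 := by
      rw [hAw]
      have : (1 + w ^ 2 / n) * (1 + w / n) ^ 2 - (1 + (2 * w + w ^ 2) / n)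
        = w ^ 2 / n ^ 2 + w ^ 2 / n * (2 * w / n + w ^ 2 / n ^ 2) := by field_simp; ring
      have : 0 ≤ w ^ 2 / n ^ 2 + w ^ 2 / n * (2 * w / n + w ^ 2 / n ^ 2) := by positivity
      linarith
    have h2 : (1 + w ^ 2 / n) ^ numNonempty s.x ≤ Real.exp (w ^ 2) := by
      have h3 : 1 + w ^ 2 / n ≤ Real.exp (w ^ 2 / n) := by
        rw [add_comm]; exact Real.add_one_le_exp _
      calc (1 + w ^ 2 / n) ^ numNonempty s.x ≤ Real.exp (w ^ 2 / n) ^ numNonempty s.x := by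
            gcongr
        _ = Real.exp (numNonempty s.x * (w ^ 2 / n)) := by rw [Real.exp_nat_mul]
        _ ≤ Real.exp (n * (w ^ 2 / n)) := by
            gcongr
            exact numNonempty_le s.x
        _ = Real.exp (w ^ 2) := by congr 1; field_simp
    calc (1 + (A * A - 1) / n) ^ numNonempty s.x
        ≤ ((1 + w ^ 2 / n) * (1 + w / n) ^ 2) ^ numNonempty s.x := by
          gcongr
          have : 0 ≤ (A * A - 1) / n := by rw [hAw]; positivity
          linarith
      _ = (1 + w ^ 2 / n) ^ numNonempty s.x * ((1 + w / n) ^ 2) ^ numNonempty s.x := mul_pow ..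
      _ ≤ _ := by gcongr
  · rw [expect_pow_arrivals_mul_of_ne hn _ _ h, one_mul]
    gcongr
    have : (1 + (A - 1) / n) ^ 2 = 1 + 2 * (A - 1) / n + ((A - 1) / n) ^ 2 := by ring
    rw [this]
    linarith [sq_nonneg ((A - 1) / n)]

lemma sq_meanWeight_sub_one_le (hA : 1 ≤ A) (k : ℕ) (s : Counted n) :
    (meanWeight A s - 1) ^ 2 ≤ weightVariance A k s := by
  have : meanWeight A s ^ 2 = (∑ i, ∑ i', weight A s i * weight A s i') / n ^ 2 := by
    rw [meanWeight, div_pow, sq (∑ i, weight A s i), sum_mul_sum]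
  rw [sub_sq, this, weightVariance, one_pow, mul_one]
  gcongr ?_ / _ - _ + _
  refine sum_le_sum fun i _ => sum_le_sum fun i' _ => ?_
  have h1 : 1 ≤ Real.exp ((A - 1) ^ 2) ^ k := one_le_pow₀ (Real.one_le_exp (sq_nonneg _))
  have h0 := mul_nonneg (weight_nonneg hA s i) (weight_nonneg hA s i')
  split_ifs
  · exact le_mul_of_one_le_left h0 h1
  · rw [one_mul]

lemma expect_weightVariance_le (hn : 1 ≤ n) (hA : 1 ≤ A) (k : ℕ) (s : Counted n) :
    𝔼 ζ, weightVariance A k (countedStep s ζ) ≤ weightVariance A (k + 1) s := by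
  have : Nonempty (Fin n) := ⟨⟨0, hn⟩⟩
  have hmean : 𝔼 ζ, meanWeight A (countedStep s ζ) = meanWeight A s := by
    simp only [meanWeight]
    rw [← expect_div, expect_sum_comm]
    simp only [expect_weight hn hA]
  simp only [weightVariance, expect_add_distrib, expect_sub_distrib, ← mul_expect, hmean,
    ← expect_div, expect_sum_comm, Fintype.expect_const]
  gcongr ?_ / _ - _ + _
  refine sum_le_sum fun i _ => sum_le_sum fun i' _ => ?_
  refine (mul_le_mul_of_nonneg_left (expect_weight_mul_le hn hA s i i') ?_).trans_eq ?_
  · split_ifs <;> positivity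
  · split_ifs
    · rw [pow_succ]; ring
    · ring

lemma weightVariance_start_le (hn : 1 ≤ n) (x : Fin n → ℕ) (k : ℕ) :
    weightVariance A k ⟨x, 0, 0, 0⟩ ≤ Real.exp ((A - 1) ^ 2) ^ k / n := by
  have hn0 : (0 : ℝ) < n := by exact_mod_cast hn
  have hw : ∀ i, weight A (⟨x, 0, 0, 0⟩ : Counted n) i = 1 := by intro i; simp [weight]
  have hm : meanWeight A (⟨x, 0, 0, 0⟩ : Counted n) = 1 := by
    simp [meanWeight, hw, hn0.ne']
  simp only [weightVariance, hw, hm]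
  set c := Real.exp ((A - 1) ^ 2) ^ k
  have : ∀ i i' : Fin n, (if i = i' then c else 1) * (1 * 1) = 1 + if i = i' then c - 1 else 0 := by
    intro i i'; split_ifs <;> ring
  simp only [this, sum_add_distrib, sum_ite_eq, mem_univ, if_true]
  simp only [sum_const, card_univ, Fintype.card_fin, nsmul_eq_mul, mul_one]
  have : (n * n + n * (c - 1)) / (n : ℝ) ^ 2 - 2 + 1 = c / n - 1 / n := by field_simp; ring
  rw [this]
  have : 0 < 1 / (n : ℝ) := by positivity
  linarith

end weight

/-! ### Blocks of rounds -/

/-- If no bin has received more than `y` balls, then the weights with base `A` are small compared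
with those with a smaller base `B`. -/
lemma meanWeight_le_exp_mul {n : ℕ} (hn : 1 ≤ n) {A B y : ℝ} (hB : 1 ≤ B) (hAB : B ≤ A)
    (s : Counted n) (hy : ∀ i, (s.Y i : ℝ) ≤ y) :
    meanWeight A s
      ≤ Real.exp ((A - B) * (y / B - s.K / (n + (A - 1)))) * meanWeight B s := by
  have hn0 : (0 : ℝ) < n := by exact_mod_cast hn
  have hB0 : 0 < B := by linarith
  have hA0 : 0 < A := by linarith
  have hA1 : 0 ≤ (A - 1) / n := div_nonneg (by linarith) hn0.le
  have hB1 : 0 ≤ (B - 1) / n := div_nonneg (by linarith) hn0.le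
  have hnA : 0 < n + (A - 1) := by linarith
  rw [meanWeight, meanWeight, ← mul_div_assoc, mul_sum]
  gcongr with i _
  have h1 : A ^ s.Y i ≤ Real.exp ((A - B) * (y / B)) * B ^ s.Y i := by
    have : A / B ≤ Real.exp ((A - B) / B) := by
      have := Real.add_one_le_exp ((A - B) / B)
      rw [sub_div, div_self hB0.ne', sub_add_cancel] at this
      rwa [sub_div, div_self hB0.ne']
    calc A ^ s.Y i = (A / B) ^ s.Y i * B ^ s.Y i := by
          rw [← mul_pow, div_mul_cancel₀ _ hB0.ne']
      _ ≤ Real.exp ((A - B) / B) ^ s.Y i * B ^ s.Y i := by gcongr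
      _ = Real.exp (s.Y i * ((A - B) / B)) * B ^ s.Y i := by rw [Real.exp_nat_mul]
      _ ≤ Real.exp (y * ((A - B) / B)) * B ^ s.Y i := by
          have : 0 ≤ (A - B) / B := div_nonneg (by linarith) hB0.le
          gcongr
          exact hy i
      _ = _ := by congr 2; ring
  have h2 : (1 + (B - 1) / n) ^ s.K
      ≤ Real.exp (-((A - B) * (s.K / (n + (A - 1))))) * (1 + (A - 1) / n) ^ s.K := by
    have h3 : (1 + (B - 1) / n) / (1 + (A - 1) / n) ≤ Real.exp (-((A - B) / (n + (A - 1)))) := by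
      have := Real.add_one_le_exp (-((A - B) / (n + (A - 1))))
      refine le_trans (le_of_eq ?_) this
      field_simp
      ring
    calc (1 + (B - 1) / n) ^ s.K
        = ((1 + (B - 1) / n) / (1 + (A - 1) / n)) ^ s.K * (1 + (A - 1) / n) ^ s.K := by
          rw [← mul_pow, div_mul_cancel₀ _ (by positivity)]
      _ ≤ Real.exp (-((A - B) / (n + (A - 1)))) ^ s.K * (1 + (A - 1) / n) ^ s.K := by gcongr
      _ = _ := by
          rw [← Real.exp_nat_mul]
          congr 2; ring
  rw [weight, weight, ← mul_div_assoc, div_le_div_iff₀ (by positivity) (by positivity), mul_sub,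
    sub_eq_add_neg ((A - B) * (y / B)), Real.exp_add]
  refine (mul_le_mul h1 h2 (by positivity) (by positivity)).trans (le_of_eq ?_)
  ring

/-- The arithmetic behind `Counted.Valid.not_concentrated`, with `r = m / n` and `K` the number of
thrown balls per bin. The gain of about `2 T / r` from the tilt outweighs the loss of about
`1.6 T / r` from the empty bins, and `T / r`, which is of order `r l`, absorbs the terms in `L`
and `r`. -/
lemma numeric_gap {r l T L K : ℝ} (hr : 1 ≤ r) (hl : 125 ≤ l) (hT : 0.1 * (r ^ 2 * l) ≤ T)
    (hL : L = 0.008 * r * l) (hK : T - 0.525 * (L + T / r) ≤ K) :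
    (L + T) / (1 + 2 / r) - K * (1 - 0.01 / r) ≤ - (r / 4) := by
  have hr0 : 0 < r := by linarith
  obtain ⟨u, hu⟩ : ∃ u, u = 1 / r := ⟨_, rfl⟩
  obtain ⟨p, hp⟩ : ∃ p, p = T / r := ⟨_, rfl⟩
  have hu0 : 0 < u := by rw [hu]; positivity
  have hu1 : u ≤ 1 := by rw [hu, div_le_one hr0]; exact hr
  have hru : r * u = 1 := by rw [hu]; field_simp
  have hTp : T * u = p := by rw [hu, hp]; ring
  have hpl : 0.1 * (r * l) ≤ p := by
    rw [hp, le_div_iff₀ hr0]; linarith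
  have hrl : 125 * r ≤ r * l := by nlinarith
  have hL0 : 0 ≤ L := by rw [hL]; positivity
  have hp0 : 0 ≤ p := by linarith [mul_pos hr0 (by linarith : 0 < l)]
  have hpT : p ≤ T := by nlinarith [hTp, mul_nonneg hp0 hr0.le, (by rw [hp]; field_simp : p * r = T)]
  rw [← hp] at hK
  rw [show 2 / r = 2 * u by rw [hu]; ring, show 0.01 / r = 0.01 * u by rw [hu]; ring]
  have hB : 0 < 1 + 2 * u := by linarith
  have hK1 : (T - 0.525 * (L + p)) * ((1 - 0.01 * u) * (1 + 2 * u))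
      ≤ K * ((1 - 0.01 * u) * (1 + 2 * u)) :=
    mul_le_mul_of_nonneg_right hK (mul_nonneg (by linarith) hB.le)
  have hk0 : 0 ≤ T - 0.525 * (L + p) := by rw [hL]; nlinarith
  have hK2 : (T - 0.525 * (L + p)) * (1 + 1.97 * u)
      ≤ (T - 0.525 * (L + p)) * ((1 - 0.01 * u) * (1 + 2 * u)) := by
    refine mul_le_mul_of_nonneg_left ?_ hk0
    nlinarith
  have e : (T - 0.525 * (L + p)) * (1 + 1.97 * u)
      = T + 1.97 * p - 0.525 * p - 0.525 * L - 0.525 * 1.97 * (L * u) - 0.525 * 1.97 * (p * u) := by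
    rw [← hTp]; ring
  have h1 : L * u ≤ L := mul_le_of_le_one_right hL0 hu1
  have h2 : p * u ≤ p := mul_le_of_le_one_right hp0 hu1
  have key : L + T + r / 4 * (1 + 2 * u) ≤ K * ((1 - 0.01 * u) * (1 + 2 * u)) := by
    have : r / 4 * (1 + 2 * u) = r / 4 + 1 / 2 := by linear_combination (1 / 2 : ℝ) * hru
    rw [this]
    have hL' : L = 0.008 * (r * l) := by rw [hL]; ring
    linarith
  have : (L + T) / (1 + 2 * u) ≤ K * (1 - 0.01 * u) - r / 4 := by
    rw [div_le_iff₀ hB]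
    linarith
  linarith

/-- After a block of `T` rounds with all loads below `L`, either many bins were empty on the way or
one of the two mean weights is far from `1`. -/
lemma Counted.Valid.not_concentrated {n m T : ℕ} {r l L : ℝ} (hn : 250 ≤ n)
    (hr : r = (m : ℝ) / n) (hr1 : 1 ≤ r) (hl : 125 ≤ l) (hL : L = 0.008 * r * l)
    (hT : 0.1 * (r ^ 2 * l) ≤ T) {s : Counted n} (hs : s.Valid m T) (hx : ∀ i, (s.x i : ℝ) < L)
    (hE : 2 * r * s.E < 1.05 * (m * L + n * T)) (hA : 0.95 < meanWeight (1 + 2.5 / r) s)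
    (hB : meanWeight (1 + 2 / r) s < 1.05) : False := by
  have hn0 : (0 : ℝ) < n := by exact_mod_cast (by omega : 0 < n)
  have hr0 : 0 < r := by linarith
  have hn' : (250 : ℝ) ≤ n := by exact_mod_cast hn
  have h := meanWeight_le_exp_mul (by omega : 1 ≤ n) (A := 1 + 2.5 / r) (B := 1 + 2 / r)
    (y := L + T) (by have : 0 ≤ 2 / r := by positivity
                     linarith) (by gcongr; norm_num) s (fun i => by
      have h1 : (s.Y i : ℝ) ≤ s.x i + T := by exact_mod_cast hs.le_add i
      linarith [hx i])
  have hKE : (s.K : ℝ) + s.E = n * T := by exact_mod_cast hs.add_eq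
  have hm : (m : ℝ) = r * n := by rw [hr]; field_simp
  have hE' : (s.E : ℝ) / n ≤ 0.525 * (L + T / r) := by
    rw [div_le_iff₀ hn0]
    have : 2 * r * (0.525 * (L + T / r) * n) = 1.05 * (m * L + n * T) := by
      rw [hm]; field_simp; ring
    have h3 : 2 * r * s.E ≤ 2 * r * (0.525 * (L + T / r) * n) := by rw [this]; exact hE.le
    exact le_of_mul_le_mul_left h3 (by positivity)
  have hK : (T : ℝ) - 0.525 * (L + T / r) ≤ s.K / n := by
    have : (s.K : ℝ) / n = T - s.E / n := by
      rw [eq_sub_iff_add_eq, ← add_div, hKE]; field_simp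
    rw [this]; linarith
  have hgap := numeric_gap hr1 hl hT hL hK
  have hK2 : (s.K : ℝ) / n * (1 - 0.01 / r) ≤ s.K / (n + (1 + 2.5 / r - 1)) := by
    rw [div_mul_eq_mul_div, div_le_div_iff₀ hn0 (by rw [add_sub_cancel_left]; positivity), mul_assoc]
    refine mul_le_mul_of_nonneg_left ?_ (Nat.cast_nonneg _)
    have h5 : 0 < 1 / r := by positivity
    have h6 : 250 * (1 / r) ≤ n * (1 / r) := by gcongr
    have e1 : (1 - 0.01 / r) * (n + (1 + 2.5 / r - 1))
      = n + (2.5 * (1 / r) - 0.01 * (n * (1 / r))) - 0.025 * (1 / r) ^ 2 := by ring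
    rw [e1]
    have := sq_nonneg (1 / r)
    linarith
  have hexp : Real.exp ((1 + 2.5 / r - (1 + 2 / r))
      * ((L + T) / (1 + 2 / r) - s.K / (n + (1 + 2.5 / r - 1)))) ≤ 8 / 9 := by
    have h4 : (1 + 2.5 / r - (1 + 2 / r))
      * ((L + T) / (1 + 2 / r) - s.K / (n + (1 + 2.5 / r - 1))) ≤ - (1 / 8) := by
      have h5 : (L + T) / (1 + 2 / r) - s.K / (n + (1 + 2.5 / r - 1)) ≤ - (r / 4) := by linarith
      have e1 : (1 + 2.5 / r - (1 + 2 / r)) = 0.5 / r := by ring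
      rw [e1]
      refine (mul_le_mul_of_nonneg_left h5 (by positivity)).trans_eq ?_
      field_simp; norm_num
    refine (Real.exp_le_exp.2 h4).trans ?_
    rw [Real.exp_neg, inv_le_comm₀ (Real.exp_pos _) (by norm_num)]
    have := Real.add_one_le_exp (1 / 8 : ℝ)
    norm_num at this ⊢
    linarith
  have hB0 : 0 ≤ meanWeight (1 + 2 / r) s := by
    have : 1 ≤ 1 + 2 / r := by
      have : 0 ≤ 2 / r := by positivity
      linarith
    exact div_nonneg (sum_nonneg fun i _ => weight_nonneg this s i) hn0.le
  have := mul_le_mul_of_nonneg_right hexp hB0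
  linarith

/-- From every start, a block of about `0.1 (m / n) ^ 2 log n` rounds sees a load of at least
`0.008 (m / n) log n` with probability at least `0.04`. -/
lemma survival_block_le {n m T : ℕ} {r l L : ℝ} (hn : 250 ≤ n) (hr : r = (m : ℝ) / n) (hr1 : 1 ≤ r)
    (hl : l = Real.log n) (hl1 : 125 ≤ l) (hL : L = 0.008 * r * l)
    (hT : 0.1 * (r ^ 2 * l) ≤ T) (hT' : T ≤ 0.108 * (r ^ 2 * l))
    (x : Fin n → ℕ) (hx : ∑ i, x i = m) :
    (killed step fun x : Fin n → ℕ => ∀ i, (x i : ℝ) < L)^[T + 1] (fun _ => 1) x ≤ 0.96 := by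
  by_cases hU : ∀ i, (x i : ℝ) < L
  swap
  · rw [Function.iterate_succ_apply', killed, if_neg hU]; norm_num
  have hn0 : (0 : ℝ) < n := by exact_mod_cast (by omega : 0 < n)
  have hn1 : 1 ≤ n := by omega
  have : Nonempty (Fin n) := ⟨⟨0, hn1⟩⟩
  have hr0 : 0 < r := by linarith
  have hm0 : 0 < (m : ℝ) := by
    have : (m : ℝ) = r * n := by rw [hr]; field_simp
    rw [this]; positivity
  have hL0 : 0 < L := by rw [hL]; positivity
  have hA : (1 : ℝ) ≤ 1 + 2.5 / r := by
    have : 0 ≤ 2.5 / r := by positivity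
    linarith
  have hB : (1 : ℝ) ≤ 1 + 2 / r := by
    have : 0 ≤ 2 / r := by positivity
    linarith
  set D : ℝ := 1.05 * (m * L + n * T) with hD
  have hD0 : 0 < D := by positivity
  -- The supermartingale combines the quadratic potential with the two weight variances. It is at
  -- least `1` at the end of a surviving block by `Counted.Valid.not_concentrated`; the factor `400`
  -- is `1 / 0.05 ^ 2`, for a deviation of the mean weight from `1` by `0.05`.
  let V : ℕ → Counted n → ℝ := fun k s =>
    (∑ i, (s.x i : ℝ) ^ 2 + 2 * r * s.E + n * k) / D
      + 400 * (weightVariance (1 + 2.5 / r) k s + weightVariance (1 + 2 / r) k s)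
  have hwv : ∀ A : ℝ, 1 ≤ A → ∀ k (s : Counted n), 0 ≤ weightVariance A k s :=
    fun A hA k s => (sq_nonneg _).trans (sq_meanWeight_sub_one_le hA k s)
  have hV0 : ∀ k s, 0 ≤ V k s := by
    intro k s
    have h1 := hwv _ hA k s
    have h2 := hwv _ hB k s
    positivity
  have hVstep : ∀ k (s : Counted n), ∑ i, s.x i = m →
      𝔼 ζ : Fin n → Fin n, V k (countedStep s ζ) ≤ V (k + 1) s := by
    intro k s hs
    simp only [V, expect_add_distrib, ← expect_div, ← mul_expect, Fintype.expect_const]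
    have h1 := expect_weightVariance_le hn1 hA k s
    have h2 := expect_weightVariance_le hn1 hB k s
    refine add_le_add ?_ (by linarith)
    gcongr ?_ / _
    have h3 := expect_sum_sq_step_le hn1 s.x m hs
    have h4 : ∀ ζ, ((countedStep s ζ).E : ℝ) = s.E + (n - numNonempty s.x) := by
      intro ζ
      simp [countedStep, Nat.cast_sub (numNonempty_le s.x)]
    simp only [h4, Fintype.expect_const]
    rw [← hr] at h3
    push_cast
    simp only [countedStep]
    linarith
  have hend : ∀ s : Counted n, s.Valid m (0 + T) →
      killed countedStep (fun s => ∀ i, (s.x i : ℝ) < L) (fun _ => 1) s ≤ V 0 s := by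
    intro s hs
    rw [zero_add] at hs
    rw [killed]
    split_ifs with hU
    swap
    · exact hV0 0 s
    rw [Fintype.expect_const]
    have hE : 2 * r * s.E ≤ ∑ i, (s.x i : ℝ) ^ 2 + 2 * r * s.E + n * ((0 : ℕ) : ℝ) := by
      have : 0 ≤ ∑ i, (s.x i : ℝ) ^ 2 := by positivity
      simpa using this
    have h1 := sq_meanWeight_sub_one_le hA 0 s
    have h2 := sq_meanWeight_sub_one_le hB 0 s
    by_contra! hlt
    have hp : 0 ≤ (∑ i, (s.x i : ℝ) ^ 2 + 2 * r * s.E + n * ((0 : ℕ) : ℝ)) / D := by positivity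
    have h3 := hwv _ hA 0 s
    have h4 := hwv _ hB 0 s
    simp only [V] at hlt
    refine hs.not_concentrated hn hr hr1 hl1 hL hT hU ?_ ?_ ?_
    · refine hE.trans_lt ((div_lt_one hD0).1 ?_)
      linarith
    · have : (meanWeight (1 + 2.5 / r) s - 1) ^ 2 < 0.05 ^ 2 := by norm_num; linarith
      linarith [(abs_lt.1 (abs_lt_of_sq_lt_sq this (by norm_num))).1]
    · have : (meanWeight (1 + 2 / r) s - 1) ^ 2 < 0.05 ^ 2 := by norm_num; linarith
      linarith [(abs_lt.1 (abs_lt_of_sq_lt_sq this (by norm_num))).2]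
  let s₀ : Counted n := ⟨x, 0, 0, 0⟩
  have hs₀ : s₀.Valid m 0 := ⟨hx, fun i => Nat.zero_le _, by simp [s₀]⟩
  have hmain : (killed step fun x : Fin n → ℕ => ∀ i, (x i : ℝ) < L)^[T + 1] (fun _ => 1) x
      ≤ V T s₀ := by
    rw [← killed_iterate_comp (upd' := countedStep) (π := Counted.x) (fun _ _ => rfl) _ _ s₀,
      Function.iterate_succ_apply]
    refine (killed_iterate_mono (fun t s ζ h => h.countedStep ζ) T 0 s₀ hend hs₀).trans ?_
    exact killed_iterate_le_of_supermartingale (Inv := fun s : Counted n => ∑ i, s.x i = m)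
      (fun s ζ h => (sum_step s.x ζ).trans h) V (fun k s _ => hV0 k s) hVstep T s₀ hx
  refine hmain.trans ?_
  have hp : (∑ i, (x i : ℝ) ^ 2 + 2 * r * ((0 : ℕ) : ℝ) + n * T) / D ≤ 1 / 1.05 := by
    rw [div_le_div_iff₀ hD0 (by norm_num), hD]
    have : ∑ i, (x i : ℝ) ^ 2 ≤ m * L := by
      have : (m : ℝ) = ∑ i, (x i : ℝ) := by rw [← hx]; push_cast; rfl
      rw [this, sum_mul]
      refine sum_le_sum fun i _ => ?_
      rw [sq]
      exact mul_le_mul_of_nonneg_left (hU i).le (Nat.cast_nonneg _)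
    push_cast
    linarith
  have hw : ∀ w : ℝ, 0 ≤ w → w ≤ 2.5 → weightVariance (1 + w / r) T s₀ ≤ 1 / 1000000 := by
    intro w hw0 hw1
    refine (weightVariance_start_le hn1 x T).trans ?_
    have h1 : (1 + w / r - 1) ^ 2 * T ≤ 0.675 * l := by
      have h2 : (1 + w / r - 1) ^ 2 = w ^ 2 / r ^ 2 := by rw [add_sub_cancel_left, div_pow]
      have h3 : w ^ 2 ≤ 2.5 ^ 2 := by gcongr
      rw [h2, div_mul_eq_mul_div, div_le_iff₀ (by positivity)]
      calc w ^ 2 * T ≤ 2.5 ^ 2 * (0.108 * (r ^ 2 * l)) := by gcongr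
        _ = _ := by ring
    have h4 : (n : ℝ) = Real.exp l := by rw [hl, Real.exp_log hn0]
    rw [← Real.exp_nat_mul, h4, ← Real.exp_sub]
    have h5 : T * (1 + w / r - 1) ^ 2 - l ≤ -40 := by linarith
    refine (Real.exp_le_exp.2 h5).trans ?_
    rw [Real.exp_neg, inv_le_comm₀ (Real.exp_pos _) (by norm_num)]
    have h6 : Real.exp 40 = Real.exp 5 ^ 8 := by rw [← Real.exp_nat_mul]; norm_num
    have h7 : (6 : ℝ) ^ 8 ≤ Real.exp 5 ^ 8 := by
      gcongr
      linarith [Real.add_one_le_exp (5 : ℝ)]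
    rw [h6]
    refine le_trans ?_ h7
    norm_num
  have h1 := hw 2.5 (by norm_num) le_rfl
  have h2 := hw 2 (by norm_num) (by norm_num)
  have e : V T s₀ = (∑ i, (x i : ℝ) ^ 2 + 2 * r * ((0 : ℕ) : ℝ) + n * T) / D
    + 400 * (weightVariance (1 + 2.5 / r) T s₀ + weightVariance (1 + 2 / r) T s₀) := rfl
  rw [e]
  norm_num at hp h1 h2 ⊢
  linarith

/-! ### The whole window -/

lemma le_mul_maxLoad {n : ℕ} (x : Fin n → ℕ) : ∑ i, x i ≤ n * maxLoad x := by
  have := sum_le_card_nsmul univ x (maxLoad x) fun i hi => le_sup (f := x) hi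
  simpa using this

lemma IsUniformSamples.measurable_load {Ω : Type*} [MeasurableSpace Ω] {μ : Measure Ω} {n : ℕ}
    {Z : ℕ → Fin n → Ω → Fin n} (hZ : IsUniformSamples μ Z) (x₀ : Fin n → ℕ) (t : ℕ) :
    Measurable fun ω => load x₀ (fun s j => Z s j ω) t := by
  induction t with
  | zero => exact measurable_const
  | succ t ih =>
    exact (measurable_of_countable fun p : (Fin n → ℕ) × (Fin n → Fin n) => step p.1 p.2).comp
      (ih.prodMk (hZ.measurable_round t))

/-- If every start with `m` balls survives a block of `T` rounds in `U` with probability at most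
`q`, then `J` blocks after an arbitrary time `t₀` are survived with probability at most `q ^ J`. -/
lemma IsUniformSamples.measureReal_survival_le {Ω : Type*} [MeasurableSpace Ω] {μ : Measure Ω}
    [IsProbabilityMeasure μ] {n m : ℕ} (hn : 1 ≤ n) {Z : ℕ → Fin n → Ω → Fin n}
    (hZ : IsUniformSamples μ Z) (x₀ : Fin n → ℕ) (hx₀ : ∑ i, x₀ i = m) (U : (Fin n → ℕ) → Prop)
    {T : ℕ} {q : ℝ} (hq : 0 ≤ q)
    (h : ∀ x : Fin n → ℕ, ∑ i, x i = m → (killed step U)^[T] (fun _ => 1) x ≤ q) (t₀ J : ℕ) :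
    μ.real {ω | ∀ s < T * J, U (load x₀ (fun s j => Z s j ω) (t₀ + s))} ≤ q ^ J := by
  classical
  have : Nonempty (Fin n) := ⟨⟨0, hn⟩⟩
  have hmeas : MeasurableSet {ω | ∀ s < T * J, U (load x₀ (fun s j => Z s j ω) (t₀ + s))} := by
    simp only [Set.ofPred_forall]
    refine MeasurableSet.iInter fun s => MeasurableSet.iInter fun _ => ?_
    exact hZ.measurable_load x₀ (t₀ + s) (Set.to_countable {x | U x}).measurableSet
  have hint := hZ.integral_survival x₀ U t₀ (T * J) fun _ => 1
  have hreal : μ.real {ω | ∀ s < T * J, U (load x₀ (fun s j => Z s j ω) (t₀ + s))}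
      = (killed step fun _ => True)^[t₀] ((killed step U)^[T * J] fun _ => 1) x₀ := by
    rw [← hint, ← integral_indicator_one hmeas]
    congr 1
    ext ω
    simp only [Set.indicator_apply, Set.mem_ofPred_eq, Pi.one_apply]
  have hInv : ∀ (x : Fin n → ℕ) ζ, ∑ i, x i = m → ∑ i, step x ζ i = m :=
    fun x ζ h => (sum_step x ζ).trans h
  rw [hreal]
  refine (killed_iterate_mono (Inv := fun _ x => ∑ i, x i = m) (V' := fun _ => q ^ J)
    (fun _ => hInv) t₀ 0 x₀ (killed_iterate_mul_le_pow hInv hq h J) hx₀).trans ?_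
  exact killed_iterate_le_of_supermartingale hInv (fun _ _ => q ^ J) (fun _ _ _ => pow_nonneg hq J)
    (fun _ _ _ => (Fintype.expect_const _).le) t₀ x₀ hx₀

end RBB

theorem mainTheorem1
    {Ω : Type*} [MeasurableSpace Ω] (μ : Measure Ω) [IsProbabilityMeasure μ]
    (n m : ℕ) (hn : 1 ≤ n) (hnm : n ≤ m)
    (k : ℝ) (hk : 1 ≤ k) (hmk : (m : ℝ) ≤ (n : ℝ) ^ k)
    (Z : ℕ → Fin n → Ω → Fin n) (hZ : RBB.IsUniformSamples μ Z)
    (x₀ : Fin n → ℕ) (hx₀ : ∑ i, x₀ i = m)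
    (γ : ℝ) (hγ : γ = (n : ℝ) / (4 * (m : ℝ)))
    (t₀ : ℕ) (t₁ : ℝ)
    (ht₁ : t₁ = (t₀ : ℝ) + (1 - γ) / 200 * (1 / γ ^ 2) * Real.log (n : ℝ) ^ 4) :
    1 - (n : ℝ)⁻¹ ≤
      μ.real {ω | ∃ t : ℕ, t₀ ≤ t ∧ (t : ℝ) ≤ t₁ ∧
        0.008 * ((m : ℝ) / (n : ℝ)) * Real.log (n : ℝ)
          ≤ (RBB.maxLoad (RBB.load x₀ (fun s j => Z s j ω) t) : ℝ)} := by
  have hn0 : (0 : ℝ) < n := by exact_mod_cast hn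
  have hnm' : (n : ℝ) ≤ m := by exact_mod_cast hnm
  have hm0 : (0 : ℝ) < m := by linarith
  obtain ⟨r, hr⟩ : ∃ r, r = (m : ℝ) / n := ⟨_, rfl⟩
  obtain ⟨l, hl⟩ : ∃ l, l = Real.log n := ⟨_, rfl⟩
  have hr1 : 1 ≤ r := by rw [hr, le_div_iff₀ hn0]; linarith
  have hr0 : 0 < r := by linarith
  have hl0 : 0 ≤ l := by rw [hl]; exact Real.log_nonneg (by exact_mod_cast hn)
  have hγ1 : γ ≤ 1 / 4 := by
    rw [hγ, div_le_div_iff₀ (by positivity) (by norm_num)]; linarith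
  have hγ2 : 1 / γ ^ 2 = 16 * r ^ 2 := by
    rw [hγ, hr]; field_simp; norm_num
  rw [hγ2, ← hl] at ht₁
  rw [← hr, ← hl]
  set W : ℝ := (1 - γ) / 200 * (16 * r ^ 2) * l ^ 4 with hW
  have hWl : 0.06 * r ^ 2 * l ^ 4 ≤ W := by
    rw [hW]
    have : 0.06 * r ^ 2 ≤ (1 - γ) / 200 * (16 * r ^ 2) := by nlinarith [sq_nonneg r]
    gcongr
  have hW0 : 0 ≤ W := le_trans (by positivity) hWl
  rcases le_or_gt l 125 with hl125 | hl125
  · -- The threshold is at most the average load.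
    have huniv : {ω | ∃ t : ℕ, t₀ ≤ t ∧ (t : ℝ) ≤ t₁ ∧
        0.008 * r * l ≤ (RBB.maxLoad (RBB.load x₀ (fun s j => Z s j ω) t) : ℝ)} = Set.univ := by
      refine Set.eq_univ_of_forall fun ω => ⟨t₀, le_rfl, by linarith, ?_⟩
      have h := RBB.le_mul_maxLoad (RBB.load x₀ (fun s j => Z s j ω) t₀)
      rw [RBB.sum_load, hx₀] at h
      have h' : r ≤ (RBB.maxLoad (RBB.load x₀ (fun s j => Z s j ω) t₀) : ℝ) := by
        rw [hr, div_le_iff₀' hn0]; exact_mod_cast h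
      nlinarith
    rw [huniv, probReal_univ]
    linarith [inv_pos.2 hn0]
  · have hexp : (n : ℝ) = Real.exp l := by rw [hl, Real.exp_log hn0]
    have hn250 : 250 ≤ n := by
      have h1 := Real.quadratic_le_exp_of_nonneg hl0
      have : (250 : ℝ) ≤ n := by rw [hexp]; nlinarith
      exact_mod_cast this
    have hrl : 125 ≤ r ^ 2 * l := by nlinarith
    -- Since `r ^ 2 * l ≥ 125`, rounding up costs at most `0.008 * (r ^ 2 * l)`.
    set T : ℕ := ⌈0.1 * (r ^ 2 * l)⌉₊ with hT
    have hT1 : 0.1 * (r ^ 2 * l) ≤ T := Nat.le_ceil _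
    have hT2 : (T : ℝ) ≤ 0.108 * (r ^ 2 * l) := by
      have := Nat.ceil_lt_add_one (a := 0.1 * (r ^ 2 * l)) (by positivity)
      rw [← hT] at this
      linarith
    set J : ℕ := ⌊W / ((T + 1 : ℕ) : ℝ)⌋₊ with hJ
    have hT0 : (0 : ℝ) < ((T + 1 : ℕ) : ℝ) := by positivity
    have hJ1 : (((T + 1) * J : ℕ) : ℝ) ≤ W := by
      have := Nat.floor_le (div_nonneg hW0 hT0.le)
      rw [← hJ, le_div_iff₀ hT0] at this
      push_cast at this ⊢
      linarith
    have hJ2 : l ≤ 0.04 * J := by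
      have h1 := Nat.lt_floor_add_one (W / ((T + 1 : ℕ) : ℝ))
      rw [← hJ] at h1
      have h2 : 0.5 * l ^ 3 ≤ W / ((T + 1 : ℕ) : ℝ) := by
        rw [le_div_iff₀ hT0]
        refine le_trans ?_ hWl
        have h3 : ((T + 1 : ℕ) : ℝ) ≤ 0.12 * (r ^ 2 * l) := by push_cast; linarith
        calc 0.5 * l ^ 3 * ((T + 1 : ℕ) : ℝ) ≤ 0.5 * l ^ 3 * (0.12 * (r ^ 2 * l)) := by gcongr
          _ = _ := by ring
      have h4 : 125 ^ 2 * l ≤ l ^ 3 := by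
        calc 125 ^ 2 * l ≤ l ^ 2 * l := by gcongr
          _ = l ^ 3 := by ring
      linarith
    have hfail := hZ.measureReal_survival_le hn x₀ hx₀ (fun x => ∀ i, (x i : ℝ) < 0.008 * r * l)
      (by norm_num) (RBB.survival_block_le hn250 hr hr1 hl hl125.le rfl hT1 hT2) t₀ J
    have hpow : (0.96 : ℝ) ^ J ≤ (n : ℝ)⁻¹ := by
      have h1 : (0.96 : ℝ) ≤ Real.exp (-0.04) := by
        have := Real.add_one_le_exp (-0.04 : ℝ)
        norm_num at this ⊢
        linarith
      calc (0.96 : ℝ) ^ J ≤ Real.exp (-0.04) ^ J := by gcongr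
        _ = Real.exp (J * (-0.04)) := by rw [Real.exp_nat_mul]
        _ ≤ Real.exp (-l) := Real.exp_le_exp.2 (by linarith)
        _ = (n : ℝ)⁻¹ := by rw [Real.exp_neg, hexp]
    set S := {ω | ∃ t : ℕ, t₀ ≤ t ∧ (t : ℝ) ≤ t₁ ∧
        0.008 * r * l ≤ (RBB.maxLoad (RBB.load x₀ (fun s j => Z s j ω) t) : ℝ)} with hS
    have hsub : Sᶜ ⊆ {ω | ∀ s < (T + 1) * J,
        ∀ i, (RBB.load x₀ (fun s j => Z s j ω) (t₀ + s) i : ℝ) < 0.008 * r * l} := by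
      intro ω hω s hs i
      by_contra! hle
      refine hω ⟨t₀ + s, by omega, ?_, hle.trans ?_⟩
      · have : (s : ℝ) ≤ (((T + 1) * J : ℕ) : ℝ) := by exact_mod_cast hs.le
        push_cast at this hJ1 ⊢
        linarith
      · exact_mod_cast Finset.le_sup (f := RBB.load x₀ (fun s j => Z s j ω) (t₀ + s))
          (Finset.mem_univ i)
    have h1 : (1 : ℝ) ≤ μ.real S + μ.real Sᶜ := by
      rw [← probReal_univ (μ := μ), ← Set.union_compl_self S]
      exact measureReal_union_le _ _
    have h2 := measureReal_mono (μ := μ) hsub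
    linarith
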